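/- Let $B,\Delta\ge 1$ be integers such that $D=\Delta B$ is a power of two. For $L\ge 0$ let $\mathrm{clip}_L(z)=z$ if $\|z\|_2\le L$ and $\mathrm{clip}_L(z)=\frac{L}{\|z\|_2}z$ otherwise. For $v=(v_1,\dots,v_\Delta)\in\mathbb R^D$ with consecutive blocks $v_i\in\mathbb R^B$ let $$\mathtt{blkclip}_B(v)=\bigl(\mathrm{clip}_{\sqrt{B/D}}(v_1),\dots,\mathrm{clip}_{\sqrt{B/D}}(v_\Delta)\bigr).$$ Let $W=SHT\in\mathbb R^{D\times D}$ be random, where $H$ is the orthonormal (Walsh–)Hadamard matrix, $H_{ij}=D^{-1/2}(-1)^{\langle i,j\rangle}$ for $0\le i,j<D$ with $\langle i,j\rangle$ the inner product of the binary digit vectors of $i$ and $j$, $S$ is a uniformly random permutation matrix, and $T$ is a diagonal matrix whose diagonal entries are independent and uniform on $\{1,-1\}$, independent of $S$. 1. There is an absolute constant $C>0$ such that for all such $B$, $D$ and every $v\in\mathbb R^D$ with $\|v\|_2\le 1$, $$\mathbb E_W\Bigl[\bigl\|W^\top\,\mathtt{blkclip}_B(Wv)-v\bigr\|_2^2\Bigr]\le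 C\,\frac{\log^2 D}{B}\qquad\text{and}\qquad \mathbb E_W\Bigl[\bigl\|W^\top\,\mathtt{blkclip}_B(Wv)-v\bigr\|_2^2\Bigr]\le C\,\frac{\log D}{\sqrt B}.$$ 2. Multiplication by $W$ and by $W^\top$ can be performed in time $O(D\log D)$: on a real RAM with unit-cost instructions (addition and truncated subtraction of indices; $+,-,\times,/$ and square root on reals; natural-number constants; array access; comparison of indices) there are two fixed programs and a constant $K$ for each of them such that, for every $D=2^m$, every matrix $W=SHT$, given as $D$ together with the array of the permutation and the array of the signs, and every $x\in\mathbb R^D$, the first program outputs $Wx$ and the second outputs $W^\top x$, in at most $K\,D\log D$ steps if $D\ge 2$ (and after finitely many steps if $D=1$). -/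

import Mathlib

open Matrix

noncomputable section

namespace SHT

/-! ### Block-wise clipping -/

/-- `clip_L(z)`: the vector `z` itself if `‖z‖₂ ≤ L`, and `(L / ‖z‖₂) z` otherwise. -/
def clip {ι : Type*} [Fintype ι] (L : ℝ) (z : EuclideanSpace ℝ ι) : EuclideanSpace ℝ ι :=
  open Classical in if ‖z‖ ≤ L then z else (L / ‖z‖) • z

/-- The `i`-th block `v_i ∈ ℝ^B` of a vector `v ∈ ℝ^D`, `D = Δ B`: its `j`-th coordinate is
coordinate `i B + j` of `v`. -/
def block {Δ B : ℕ} (v : EuclideanSpace ℝ (Fin (Δ * B))) (i : Fin Δ) :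
    EuclideanSpace ℝ (Fin B) :=
  WithLp.toLp 2 fun j => v (finProdFinEquiv (i, j))

/-- The vector of `ℝ^D`, `D = Δ B`, with the given `Δ` consecutive blocks of size `B`. -/
def ofBlocks {Δ B : ℕ} (u : Fin Δ → EuclideanSpace ℝ (Fin B)) :
    EuclideanSpace ℝ (Fin (Δ * B)) :=
  WithLp.toLp 2 fun k => u (finProdFinEquiv.symm k).1 (finProdFinEquiv.symm k).2

/-- `blkclip_B`: every block of size `B` is clipped to Euclidean norm `√(B / D)`, `D = Δ B`. -/
def blkclip {Δ B : ℕ} (v : EuclideanSpace ℝ (Fin (Δ * B))) : EuclideanSpace ℝ (Fin (Δ * B)) :=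
  ofBlocks fun i => clip (Real.sqrt ((B : ℝ) / ((Δ * B : ℕ) : ℝ))) (block v i)

/-! ### The random matrix `W = S H T` -/

/-- The (orthonormal) Hadamard matrix of order `D`, a power of two: the entry at `(i, j)` is
`D^{-1/2} (-1)^{⟨i, j⟩}`, where `⟨i, j⟩` is the number of common ones among the
`log₂ D` binary digits of `i` and `j`. -/
def walshHadamard (D : ℕ) : Matrix (Fin D) (Fin D) ℝ :=
  Matrix.of fun i j =>
    (-1) ^ ((Finset.range (Nat.log 2 D)).filter
      fun k => (i : ℕ).testBit k = true ∧ (j : ℕ).testBit k = true).card / Real.sqrt D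

/-- `W = S H T` with `S` the permutation matrix of `σ` (so `(S x)_i = x_{σ i}`) and `T` the
diagonal matrix of the signs `ε`. -/
def sht {D : ℕ} (σ : Equiv.Perm (Fin D)) (ε : Fin D → ℤˣ) : Matrix (Fin D) (Fin D) ℝ :=
  σ.permMatrix ℝ * walshHadamard D * Matrix.diagonal fun i => (((ε i : ℤˣ) : ℤ) : ℝ)

/-- The joint law of the permutation and of the signs: the permutation is uniform, the signs are
independent and uniform on `{1, -1}`, and permutation and signs are independent; that is, the
pair is uniform on the finite product set. -/
def shtSeed (D : ℕ) : PMF (Equiv.Perm (Fin D) × (Fin D → ℤˣ)) :=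
  PMF.uniformOfFintype _

/-- The expectation `E_W [f W]` over the random matrix `W = S H T` of order `D`. -/
def shtExpectation (D : ℕ) (f : Matrix (Fin D) (Fin D) ℝ → ℝ) : ℝ :=
  ∑ ω : Equiv.Perm (Fin D) × (Fin D → ℤˣ), (shtSeed D ω).toReal * f (sht ω.1 ω.2)

/-- The expected squared error `E_W ‖Wᵀ blkclip_B(W v) - v‖₂²`. -/
def expectedError {Δ B : ℕ} (v : EuclideanSpace ℝ (Fin (Δ * B))) : ℝ :=
  shtExpectation (Δ * B) fun W =>
    ‖Matrix.toEuclideanLin Wᵀ (blkclip (Matrix.toEuclideanLin W v)) - v‖ ^ 2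

/-! ### A unit-cost real RAM with structured control flow -/

/-- The memory: index (natural-number) registers, real registers, and countably many named arrays
of indices and of reals. A program mentions only finitely many registers and array names;
arrays are addressed indirectly, through an index register. -/
structure Mem where
  idx : ℕ → ℕ
  val : ℕ → ℝ
  idxArr : ℕ → ℕ → ℕ
  valArr : ℕ → ℕ → ℝ

/-- Elementary instructions. Natural numbers name registers and arrays, except for the constant
`c`, which is a literal. There is no multiplication of indices, and the only literal
constants are natural numbers. -/
inductive Instr where
  /-- `idx x := c` -/
  | iconst (x c : ℕ)
  /-- `idx x := idx y + idx z` -/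
  | iadd (x y z : ℕ)
  /-- `idx x := idx y - idx z`, truncated at `0` -/
  | isub (x y z : ℕ)
  /-- `idx x := idxArr a [idx y]` -/
  | iload (x a y : ℕ)
  /-- `idxArr a [idx y] := idx x` -/
  | istore (a y x : ℕ)
  /-- `val x := c` -/
  | rconst (x c : ℕ)
  /-- `val x := val y + val z` -/
  | radd (x y z : ℕ)
  /-- `val x := val y - val z` -/
  | rsub (x y z : ℕ)
  /-- `val x := val y * val z` -/
  | rmul (x y z : ℕ)
  /-- `val x := val y / val z` -/
  | rdiv (x y z : ℕ)
  /-- `val x := √(val y)` -/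
  | rsqrt (x y : ℕ)
  /-- `val x := valArr a [idx y]` -/
  | rload (x a y : ℕ)
  /-- `valArr a [idx y] := val x` -/
  | rstore (a y x : ℕ)

/-- The arrays `A` after writing `z` into cell `i` of the array named `a`. -/
def writeArr {α : Type*} (A : ℕ → ℕ → α) (a i : ℕ) (z : α) : ℕ → ℕ → α :=
  Function.update A a (Function.update (A a) i z)

/-- The effect of one instruction on the memory. -/
def Instr.run : Instr → Mem → Mem
  | .iconst x c, s => { s with idx := Function.update s.idx x c }
  | .iadd x y z, s => { s with idx := Function.update s.idx x (s.idx y + s.idx z) }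
  | .isub x y z, s => { s with idx := Function.update s.idx x (s.idx y - s.idx z) }
  | .iload x a y, s => { s with idx := Function.update s.idx x (s.idxArr a (s.idx y)) }
  | .istore a y x, s => { s with idxArr := writeArr s.idxArr a (s.idx y) (s.idx x) }
  | .rconst x c, s => { s with val := Function.update s.val x (c : ℝ) }
  | .radd x y z, s => { s with val := Function.update s.val x (s.val y + s.val z) }
  | .rsub x y z, s => { s with val := Function.update s.val x (s.val y - s.val z) }
  | .rmul x y z, s => { s with val := Function.update s.val x (s.val y * s.val z) }
  | .rdiv x y z, s => { s with val := Function.update s.val x (s.val y / s.val z) }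
  | .rsqrt x y, s => { s with val := Function.update s.val x (Real.sqrt (s.val y)) }
  | .rload x a y, s => { s with val := Function.update s.val x (s.valArr a (s.idx y)) }
  | .rstore a y x, s => { s with valArr := writeArr s.valArr a (s.idx y) (s.val x) }

/-- Programs: finite pieces of code, independent of the input. -/
inductive Prog where
  | instr (a : Instr)
  | seq (p q : Prog)
  /-- `if idx x < idx y then p else q` -/
  | ite (x y : ℕ) (p q : Prog)
  /-- `while idx x < idx y do p` -/
  | while (x y : ℕ) (p : Prog)

/-- `Exec p s t s'`: started in memory `s`, the program `p` halts after exactly `t` steps in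
memory `s'`. Each instruction and each evaluation of a test is one step. -/
inductive Exec : Prog → Mem → ℕ → Mem → Prop
  | instr (a : Instr) (s : Mem) : Exec (.instr a) s 1 (a.run s)
  | seq {p q : Prog} {s₁ s₂ s₃ : Mem} {t₁ t₂ : ℕ} :
      Exec p s₁ t₁ s₂ → Exec q s₂ t₂ s₃ → Exec (.seq p q) s₁ (t₁ + t₂) s₃
  | ite_true {x y : ℕ} {p q : Prog} {s s' : Mem} {t : ℕ} :
      s.idx x < s.idx y → Exec p s t s' → Exec (.ite x y p q) s (t + 1) s'
  | ite_false {x y : ℕ} {p q : Prog} {s s' : Mem} {t : ℕ} :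
      ¬ s.idx x < s.idx y → Exec q s t s' → Exec (.ite x y p q) s (t + 1) s'
  | while_true {x y : ℕ} {p : Prog} {s₁ s₂ s₃ : Mem} {t₁ t₂ : ℕ} :
      s₁.idx x < s₁.idx y → Exec p s₁ t₁ s₂ → Exec (.while x y p) s₂ t₂ s₃ →
        Exec (.while x y p) s₁ (t₁ + t₂ + 1) s₃
  | while_false {x y : ℕ} {p : Prog} {s : Mem} :
      ¬ s.idx x < s.idx y → Exec (.while x y p) s 1 s

/-- The memory `s` holds the input `(D, σ, ε, x)`: index register `0` holds `D`, index array `0`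
the permutation, real array `0` the vector and real array `1` the signs. All the other
contents of the memory are arbitrary. -/
def IsInput {D : ℕ} (σ : Equiv.Perm (Fin D)) (ε : Fin D → ℤˣ) (x : Fin D → ℝ) (s : Mem) : Prop :=
  s.idx 0 = D ∧ ∀ i : Fin D,
    s.idxArr 0 i = (σ i : ℕ) ∧ s.valArr 0 i = x i ∧ s.valArr 1 i = (((ε i : ℤˣ) : ℤ) : ℝ)

/-- The program `p` multiplies by `f W`, for every matrix `W = S H T` of every order `D = 2^m` (given
through its permutation and its signs) and every real vector, leaving the product in real array
`2`, within `K D log D` steps if `D ≥ 2` (for `D = 1` the bound would read `0`). -/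
def MultipliesWithin (f : ∀ {D : ℕ}, Matrix (Fin D) (Fin D) ℝ → Matrix (Fin D) (Fin D) ℝ)
    (p : Prog) (K : ℝ) : Prop :=
  ∀ (m D : ℕ), D = 2 ^ m →
    ∀ (σ : Equiv.Perm (Fin D)) (ε : Fin D → ℤˣ) (x : Fin D → ℝ) (s : Mem), IsInput σ ε x s →
      ∃ (t : ℕ) (s' : Mem), Exec p s t s' ∧
        (∀ i : Fin D, s'.valArr 2 i = (f (sht σ ε) *ᵥ x) i) ∧
        (2 ≤ D → (t : ℝ) ≤ K * (D * Real.log D))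

end SHT

end

/-! Accuracy. `W` is orthogonal, so the error equals the clipping error of `y = W v`. With `c =
‖v‖²` and clipping radius `L`, `L² = 1/Δ`, a block `z` satisfies `L ‖clip L z - z‖ ≤ |‖z‖² - c/Δ|`
(`mul_norm_clip_sub_le`), and `c/Δ` is the mean of `‖z‖²` under the random permutation. Only a
variance is therefore needed. For fixed signs, a block samples the squared coordinates of `u = H T
v` without replacement, which is no worse than sampling with replacement (`sum_perm_sq_sum_le`); the
error averaged over permutations is thus at most `Δ ∑ u_k⁴`. Each `u_k` is a sign sum with variance
`c/D ≤ 1/D`, so Khintchine gives `E u_k⁴ ≤ 3/D²` (`sum_signs_moments`), and the total is at most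
`3Δ/D = 3/B` (`expectedError_le`). This implies both bounds once `log D ≥ log 2`; for `D = 1` the
error is zero.

Speed. The Hadamard transform is `log₂ D` repetitions of one and the same butterfly, which reads
adjacent pairs and writes sums to the first half and differences to the second
(`iterate_butterfly`). Every stage has the same addressing pattern, so indices need only additions.
Signs and permutation are applied in the linear loops before and after the transform. -/

namespace SHT

/-! ### The Walsh signs and the Hadamard matrix -/

/-- The sign `(-1)^{⟨i, j⟩}`, the inner product being over the `m` lowest binary digits. -/
noncomputable def walshSign (m i j : ℕ) : ℝ :=
  (-1) ^ ((Finset.range m).filter fun k => i.testBit k = true ∧ j.testBit k = true).card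

@[simp] theorem walshSign_zero (i j : ℕ) : walshSign 0 i j = 1 := by simp [walshSign]

theorem walshSign_succ (m i j : ℕ) :
    walshSign (m + 1) i j =
      walshSign m i j * if i.testBit m = true ∧ j.testBit m = true then -1 else 1 := by
  unfold walshSign
  rw [Finset.range_add_one, Finset.filter_insert]
  split_ifs
  · rw [Finset.card_insert_of_notMem (by simp), pow_succ]
  · rw [mul_one]

theorem walshSign_comm (m i j : ℕ) : walshSign m i j = walshSign m j i := by
  unfold walshSign
  simp only [and_comm]

theorem walshSign_mul_self (m i j : ℕ) : walshSign m i j * walshSign m i j = 1 := by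
  unfold walshSign
  rw [← mul_pow]
  norm_num

theorem walshSign_congr {m i i' j j' : ℕ} (hi : ∀ k < m, i.testBit k = i'.testBit k)
    (hj : ∀ k < m, j.testBit k = j'.testBit k) : walshSign m i j = walshSign m i' j' := by
  unfold walshSign
  congr 2
  refine Finset.filter_congr fun k hk => ?_
  rw [hi k (Finset.mem_range.1 hk), hj k (Finset.mem_range.1 hk)]

/-- Only the digits up to position `m` count, so of `a` and `c` just the lowest digit enters. This
is the block recursion of the Hadamard matrix. -/
theorem walshSign_two_pow_mul_add {m i j : ℕ} (a c : ℕ) (hi : i < 2 ^ m) (hj : j < 2 ^ m) :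
    walshSign (m + 1) (2 ^ m * a + i) (2 ^ m * c + j) =
      walshSign m i j * if a.testBit 0 = true ∧ c.testBit 0 = true then -1 else 1 := by
  rw [walshSign_succ, Nat.testBit_two_pow_mul_add _ hi, Nat.testBit_two_pow_mul_add _ hj,
    walshSign_congr (i' := i) (j' := j)]
  · simp
  all_goals
    intro k hk
    rw [Nat.testBit_two_pow_mul_add _ (by assumption), if_pos hk]

theorem sum_range_two_pow_succ (m : ℕ) (f : ℕ → ℝ) :
    ∑ j ∈ Finset.range (2 ^ (m + 1)), f j =
      ∑ j ∈ Finset.range (2 ^ m), f j + ∑ j ∈ Finset.range (2 ^ m), f (2 ^ m * 1 + j) := by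
  rw [pow_succ, mul_two, Finset.sum_range_add, mul_one]

/-- The character sum factors over the digits of `j`: digit `k` contributes `1 + 1` or `1 - 1`
according to whether `i` and `i'` agree there. Orthogonality of the rows follows, as distinct
indices below `2 ^ m` differ in some digit below `m`. -/
theorem sum_walshSign_mul_walshSign (m i i' : ℕ) :
    ∑ j ∈ Finset.range (2 ^ m), walshSign m i j * walshSign m i' j =
      ∏ k ∈ Finset.range m, if i.testBit k = i'.testBit k then (2 : ℝ) else 0 := by
  induction m with
  | zero => simp
  | succ m ih =>
    rw [sum_range_two_pow_succ, Finset.prod_range_succ, ← ih, ← Finset.sum_add_distrib,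
      Finset.sum_mul]
    refine Finset.sum_congr rfl fun j hj => ?_
    have hj := Finset.mem_range.1 hj
    have h0 : j.testBit m = false := Nat.testBit_lt_two_pow hj
    have h1 : (2 ^ m * 1 + j).testBit m = true := by
      rw [Nat.testBit_two_pow_mul_add _ hj]; simp
    have h2 (i : ℕ) : walshSign m i (2 ^ m * 1 + j) = walshSign m i j :=
      walshSign_congr (fun _ _ => rfl) fun k hk => by
        rw [Nat.testBit_two_pow_mul_add _ hj, if_pos hk]
    simp only [walshSign_succ, h0, h1, h2]
    cases i.testBit m <;> cases i'.testBit m <;> simp <;> ring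

theorem sum_walshSign_mul_walshSign_eq {m i i' : ℕ} (hi : i < 2 ^ m) (hi' : i' < 2 ^ m) :
    ∑ j ∈ Finset.range (2 ^ m), walshSign m i j * walshSign m i' j =
      if i = i' then 2 ^ m else 0 := by
  rw [sum_walshSign_mul_walshSign]
  split_ifs with h
  · simp [h]
  · obtain ⟨k, hk⟩ := Nat.exists_testBit_ne_of_ne h
    have hkm : k < m := by
      by_contra hkm
      have hle : 2 ^ m ≤ 2 ^ k := Nat.pow_le_pow_right (by norm_num) (not_lt.1 hkm)
      exact hk (by rw [Nat.testBit_lt_two_pow (hi.trans_le hle),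
        Nat.testBit_lt_two_pow (hi'.trans_le hle)])
    exact Finset.prod_eq_zero (Finset.mem_range.2 hkm) (if_neg hk)

theorem walshHadamard_apply {D m : ℕ} (hD : D = 2 ^ m) (i j : Fin D) :
    walshHadamard D i j = walshSign m i j / Real.sqrt D := by
  have h : Nat.log 2 D = m := by rw [hD, Nat.log_pow (by norm_num)]
  rw [walshHadamard, Matrix.of_apply, h, walshSign]

theorem walshHadamard_transpose (D : ℕ) : (walshHadamard D)ᵀ = walshHadamard D := by
  ext i j
  simp only [walshHadamard, Matrix.transpose_apply, Matrix.of_apply, and_comm]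

theorem walshHadamard_mul_self {D m : ℕ} (hD : D = 2 ^ m) :
    walshHadamard D * walshHadamard D = 1 := by
  ext i j
  have hD0 : (0 : ℝ) < D := by rw [hD]; positivity
  rw [Matrix.mul_apply, Matrix.one_apply]
  have h (k : Fin D) : walshHadamard D i k * walshHadamard D k j =
      walshSign m i k * walshSign m j k / D := by
    rw [walshHadamard_apply hD, walshHadamard_apply hD, walshSign_comm m k j, div_mul_div_comm,
      Real.mul_self_sqrt hD0.le]
  rw [Finset.sum_congr rfl fun k _ => h k, ← Finset.sum_div,
    Fin.sum_univ_eq_sum_range (fun k => walshSign m i k * walshSign m j k) D]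
  have hs := sum_walshSign_mul_walshSign_eq (m := m) (i.2.trans_eq hD) (j.2.trans_eq hD)
  rw [← hD] at hs
  rw [hs]
  by_cases hij : i = j
  · subst hij
    simp only [if_true]
    rw [hD]
    push_cast
    exact div_self (by positivity)
  · rw [if_neg (fun h => hij (Fin.ext h)), if_neg hij, zero_div]

theorem walshHadamard_mulVec {D m : ℕ} (hD : D = 2 ^ m) (x : ℕ → ℝ) (i : Fin D) :
    (walshHadamard D *ᵥ fun j => x j) i =
      (∑ j ∈ Finset.range (2 ^ m), walshSign m i j * x j) / Real.sqrt D := by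
  rw [← hD, ← Fin.sum_univ_eq_sum_range (fun j => walshSign m i j * x j), Finset.sum_div]
  change ∑ j, walshHadamard D i j * x j = _
  refine Finset.sum_congr rfl fun j _ => ?_
  rw [walshHadamard_apply hD]
  ring

/-! ### The action of `W` and its transpose; orthogonality. -/

theorem permMatrix_mulVec_apply {D : ℕ} (σ : Equiv.Perm (Fin D)) (x : Fin D → ℝ) (i : Fin D) :
    (σ.permMatrix ℝ *ᵥ x) i = x (σ i) := by
  rw [Matrix.permMatrix_mulVec]; rfl

theorem sht_mulVec {D : ℕ} (σ : Equiv.Perm (Fin D)) (ε : Fin D → ℤˣ) (x : Fin D → ℝ) (i : Fin D) :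
    (sht σ ε *ᵥ x) i = (walshHadamard D *ᵥ fun j => (((ε j : ℤˣ) : ℤ) : ℝ) * x j) (σ i) := by
  rw [sht, ← Matrix.mulVec_mulVec, ← Matrix.mulVec_mulVec, permMatrix_mulVec_apply]
  congr 2
  ext j
  rw [Matrix.mulVec_diagonal]

theorem sht_transpose_mulVec {D : ℕ} (σ : Equiv.Perm (Fin D)) (ε : Fin D → ℤˣ) (x : Fin D → ℝ)
    (i : Fin D) :
    ((sht σ ε)ᵀ *ᵥ x) i =
      (((ε i : ℤˣ) : ℤ) : ℝ) * (walshHadamard D *ᵥ fun j => x (σ.symm j)) i := by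
  rw [sht, Matrix.transpose_mul, Matrix.transpose_mul, walshHadamard_transpose,
    Matrix.diagonal_transpose, Matrix.transpose_permMatrix, ← Matrix.mulVec_mulVec,
    ← Matrix.mulVec_mulVec, Matrix.mulVec_diagonal]
  congr 3
  ext j
  rw [permMatrix_mulVec_apply]
  rfl

theorem sht_transpose_mul_self {D m : ℕ} (hD : D = 2 ^ m) (σ : Equiv.Perm (Fin D))
    (ε : Fin D → ℤˣ) : (sht σ ε)ᵀ * sht σ ε = 1 := by
  have h : ∀ x, (sht σ ε)ᵀ *ᵥ (sht σ ε *ᵥ x) = x := by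
    intro x
    ext i
    have h1 : (fun j => (sht σ ε *ᵥ x) (σ.symm j)) =
        walshHadamard D *ᵥ fun j => (((ε j : ℤˣ) : ℤ) : ℝ) * x j := by
      ext j; rw [sht_mulVec, Equiv.apply_symm_apply]
    rw [sht_transpose_mulVec, h1, Matrix.mulVec_mulVec, walshHadamard_mul_self hD,
      Matrix.one_mulVec, ← mul_assoc]
    rcases Int.units_eq_one_or (ε i) with h | h <;> simp [h]
  refine Matrix.ext_of_mulVec_single fun j => ?_
  rw [← Matrix.mulVec_mulVec, h, Matrix.one_mulVec]

end SHT
namespace SHT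

/-! ### Uniform permutations and random signs -/

/-- Composing with a transposition shows that the sum does not depend on `k`; averaging over `k`
then gives the claim. -/
theorem card_mul_sum_perm_apply {ι : Type*} [Fintype ι] [DecidableEq ι] (w : ι → ℝ) (k : ι) :
    (Fintype.card ι : ℝ) * ∑ σ : Equiv.Perm ι, w (σ k) =
      Fintype.card (Equiv.Perm ι) * ∑ j, w j := by
  have h (l : ι) : ∑ σ : Equiv.Perm ι, w (σ l) = ∑ σ : Equiv.Perm ι, w (σ k) :=
    Fintype.sum_equiv (Equiv.mulRight (Equiv.swap l k)) _ _ fun σ => by simp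
  calc (Fintype.card ι : ℝ) * ∑ σ : Equiv.Perm ι, w (σ k)
      = ∑ l, ∑ σ : Equiv.Perm ι, w (σ l) := by
        rw [Finset.sum_congr rfl fun l _ => h l]; simp
    _ = ∑ σ : Equiv.Perm ι, ∑ l, w (σ l) := Finset.sum_comm
    _ = Fintype.card (Equiv.Perm ι) * ∑ j, w j := by
        rw [Finset.sum_congr rfl fun σ _ => Equiv.sum_comp σ w]
        rw [Finset.sum_const, Finset.card_univ, nsmul_eq_mul]

/-- Two values of a centred function at distinct places of a uniform permutation are negatively
correlated. -/
theorem sum_perm_mul_nonpos {ι : Type*} [Fintype ι] [DecidableEq ι] (w : ι → ℝ)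
    (hw : ∑ j, w j = 0) {k l : ι} (hkl : k ≠ l) :
    ∑ σ : Equiv.Perm ι, w (σ k) * w (σ l) ≤ 0 := by
  have h (j : ι) (hj : j ∈ Finset.univ.erase k) : ∑ σ : Equiv.Perm ι, w (σ k) * w (σ j) =
      ∑ σ : Equiv.Perm ι, w (σ k) * w (σ l) :=
    Fintype.sum_equiv (Equiv.mulRight (Equiv.swap j l)) _ _ fun σ => by
      simp [Equiv.swap_apply_of_ne_of_ne (Finset.ne_of_mem_erase hj).symm hkl]
  -- By symmetry every `j ≠ k` yields the same correlation, and centring gives `∑_{j ≠ k} w (σ j) =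
  -- -w (σ k)`. Adding up the correlations leaves minus a sum of squares.
  have h1 : ((Finset.univ.erase k).card : ℝ) * ∑ σ : Equiv.Perm ι, w (σ k) * w (σ l) =
      ∑ σ : Equiv.Perm ι, -(w (σ k) * w (σ k)) := by
    rw [← nsmul_eq_mul, ← Finset.sum_const, ← Finset.sum_congr rfl h, Finset.sum_comm]
    refine Finset.sum_congr rfl fun σ _ => ?_
    have h2 := Finset.add_sum_erase Finset.univ (fun j => w (σ j)) (Finset.mem_univ k)
    rw [Equiv.sum_comp σ w, hw] at h2
    rw [← Finset.mul_sum, eq_neg_of_add_eq_zero_right h2, mul_neg]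
  have h2 : 0 < ((Finset.univ.erase k).card : ℝ) := by
    exact_mod_cast Finset.card_pos.2 ⟨l, Finset.mem_erase.2 ⟨hkl.symm, Finset.mem_univ l⟩⟩
  have h3 : ∑ σ : Equiv.Perm ι, -(w (σ k) * w (σ k)) ≤ 0 :=
    Finset.sum_nonpos fun σ _ => neg_nonpos.2 (mul_self_nonneg _)
  by_contra h4
  exact absurd (h1 ▸ mul_pos h2 (not_le.1 h4)) (not_lt.2 h3)

/-- The variance of a sum sampled without replacement is at most the one with replacement. -/
theorem sum_perm_sq_sum_le {ι κ : Type*} [Fintype ι] [DecidableEq ι] [Fintype κ] (w : ι → ℝ)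
    (hw : ∑ j, w j = 0) (f : κ → ι) (hf : Function.Injective f) :
    (Fintype.card ι : ℝ) * ∑ σ : Equiv.Perm ι, (∑ k, w (σ (f k))) ^ 2 ≤
      Fintype.card κ * (Fintype.card (Equiv.Perm ι) * ∑ j, w j ^ 2) := by
  classical
  have h1 : ∑ σ : Equiv.Perm ι, (∑ k, w (σ (f k))) ^ 2 =
      ∑ k, ∑ l, ∑ σ : Equiv.Perm ι, w (σ (f k)) * w (σ (f l)) := by
    simp only [sq, Finset.sum_mul_sum]
    rw [Finset.sum_comm]
    exact Finset.sum_congr rfl fun k _ => Finset.sum_comm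
  -- Off-diagonal terms are nonpositive since `f` is injective; only the diagonal survives.
  have h2 (k : κ) : ∑ l, ∑ σ : Equiv.Perm ι, w (σ (f k)) * w (σ (f l)) ≤
      ∑ σ : Equiv.Perm ι, w (σ (f k)) ^ 2 := by
    rw [← Finset.add_sum_erase _ _ (Finset.mem_univ k)]
    simp only [← sq]
    refine add_le_of_nonpos_right (Finset.sum_nonpos fun l hl => ?_)
    exact sum_perm_mul_nonpos w hw (hf.ne (Finset.ne_of_mem_erase hl).symm)
  rw [h1]
  refine (mul_le_mul_of_nonneg_left (Finset.sum_le_sum fun k _ => h2 k)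
    (Nat.cast_nonneg _)).trans (le_of_eq ?_)
  rw [Finset.mul_sum,
    Finset.sum_congr rfl fun k _ => card_mul_sum_perm_apply (fun j => w j ^ 2) (f k)]
  simp

/-- Khintchine's inequality for the fourth moment, together with the second moment. -/
theorem sum_signs_moments (n : ℕ) (a : Fin n → ℝ) :
    ∑ ε : Fin n → ℤˣ, (∑ i, (((ε i : ℤˣ) : ℤ) : ℝ) * a i) ^ 2 =
        (2 : ℝ) ^ n * ∑ i, a i ^ 2 ∧
      ∑ ε : Fin n → ℤˣ, (∑ i, (((ε i : ℤˣ) : ℤ) : ℝ) * a i) ^ 4 ≤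
        (2 : ℝ) ^ n * (3 * (∑ i, a i ^ 2) ^ 2) := by
  induction n with
  | zero => simp
  | succ n ih =>
    obtain ⟨h2, h4⟩ := ih fun i => a i.succ
    -- Split according to the first sign; odd powers of `a 0` cancel between the two halves.
    have key (p : ℕ) : ∑ ε : Fin (n + 1) → ℤˣ, (∑ i, (((ε i : ℤˣ) : ℤ) : ℝ) * a i) ^ p =
        ∑ ε : Fin n → ℤˣ, ((a 0 + ∑ i, (((ε i : ℤˣ) : ℤ) : ℝ) * a i.succ) ^ p +
          (-a 0 + ∑ i, (((ε i : ℤˣ) : ℤ) : ℝ) * a i.succ) ^ p) := by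
      rw [← (Fin.consEquiv fun _ : Fin (n + 1) => ℤˣ).sum_comp, Fintype.sum_prod_type,
        Finset.sum_add_distrib]
      have hu : (Finset.univ : Finset ℤˣ) = {1, -1} := rfl
      rw [hu, Finset.sum_pair (by decide)]
      simp [Fin.consEquiv, Fin.sum_univ_succ]
    have hc : (Fintype.card (Fin n → ℤˣ) : ℝ) = 2 ^ n := by simp
    constructor
    · rw [key, Fin.sum_univ_succ (fun i => a i ^ 2)]
      have h (s : ℝ) : (a 0 + s) ^ 2 + (-a 0 + s) ^ 2 = 2 * a 0 ^ 2 + 2 * s ^ 2 := by ring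
      simp only [h]
      simp only [Finset.sum_add_distrib, ← Finset.mul_sum, h2, Finset.sum_const,
        Finset.card_univ, nsmul_eq_mul, hc]
      ring
    · rw [key, Fin.sum_univ_succ (fun i => a i ^ 2)]
      have h (s : ℝ) : (a 0 + s) ^ 4 + (-a 0 + s) ^ 4 =
          2 * a 0 ^ 4 + 12 * a 0 ^ 2 * s ^ 2 + 2 * s ^ 4 := by ring
      simp only [h]
      simp only [Finset.sum_add_distrib, ← Finset.mul_sum, h2, Finset.sum_const,
        Finset.card_univ, nsmul_eq_mul, hc]
      -- With `S` the sum of the remaining squares, `2 a₀⁴ + 12 a₀² S + 6 S² = 6 (a₀² + S)² - 4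
      -- a₀⁴`; the constant 3 makes the cross terms match.
      have h5 : 0 ≤ (2 : ℝ) ^ n * a 0 ^ 4 := by positivity
      rw [pow_succ (2 : ℝ) n]
      nlinarith [h4, h5]

/-! ### The clipping error -/

/-- When clipping acts, `L (‖z‖ - L) ≤ (‖z‖ + L) (‖z‖ - L) = ‖z‖² - L² ≤ ‖z‖² - L² c`. The free
parameter `c` lets the right side be centred at its mean. -/
theorem mul_norm_clip_sub_le {ι : Type*} [Fintype ι] {L c : ℝ} (hL : 0 < L) (hc : c ≤ 1)
    (z : EuclideanSpace ℝ ι) : L * ‖clip L z - z‖ ≤ |‖z‖ ^ 2 - L ^ 2 * c| := by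
  unfold clip
  split_ifs with h
  · simp
  · have h := not_le.1 h
    have hz : 0 < ‖z‖ := hL.trans h
    have h1 : (L / ‖z‖) • z - z = (L / ‖z‖ - 1) • z := by rw [sub_smul, one_smul]
    have h2 : L / ‖z‖ - 1 = -((‖z‖ - L) / ‖z‖) := by field_simp; ring
    rw [h1, norm_smul, h2, norm_neg, Real.norm_of_nonneg (by
      exact div_nonneg (sub_nonneg.2 h.le) hz.le), div_mul_cancel₀ _ hz.ne']
    refine le_trans ?_ (le_abs_self _)
    nlinarith [mul_nonneg (sq_nonneg L) (sub_nonneg.2 hc), mul_pos hz (sub_pos.2 h)]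

theorem norm_sq_eq_sum_block {Δ B : ℕ} (v : EuclideanSpace ℝ (Fin (Δ * B))) :
    ‖v‖ ^ 2 = ∑ i, ‖block v i‖ ^ 2 := by
  rw [EuclideanSpace.norm_sq_eq, ← finProdFinEquiv.sum_comp, Fintype.sum_prod_type]
  refine Finset.sum_congr rfl fun i _ => ?_
  rw [EuclideanSpace.norm_sq_eq]
  rfl

theorem block_blkclip_sub {Δ B : ℕ} (y : EuclideanSpace ℝ (Fin (Δ * B))) (i : Fin Δ) :
    block (blkclip y - y) i =
      clip (Real.sqrt ((B : ℝ) / ((Δ * B : ℕ) : ℝ))) (block y i) - block y i := by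
  ext j
  simp only [block, blkclip, ofBlocks, PiLp.sub_apply, Equiv.symm_apply_apply]

theorem norm_blkclip_sub_sq_le {Δ B : ℕ} (hΔ : 0 < Δ) (hB : 0 < B) {c : ℝ} (hc : c ≤ 1)
    (y : EuclideanSpace ℝ (Fin (Δ * B))) :
    ‖blkclip y - y‖ ^ 2 ≤
      Δ * ∑ i, (∑ j, (y (finProdFinEquiv (i, j)) ^ 2 - c / (Δ * B : ℕ))) ^ 2 := by
  rw [norm_sq_eq_sum_block, Finset.mul_sum]
  refine Finset.sum_le_sum fun i _ => ?_
  have hΔ' : (0 : ℝ) < Δ := by exact_mod_cast hΔ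
  have hB' : (0 : ℝ) < B := by exact_mod_cast hB
  have hL : (B : ℝ) / ((Δ * B : ℕ) : ℝ) = 1 / Δ := by push_cast; field_simp
  rw [block_blkclip_sub, hL]
  have h1 := mul_norm_clip_sub_le (L := Real.sqrt (1 / Δ)) (by positivity) hc (block y i)
  rw [Real.sq_sqrt (by positivity)] at h1
  have h2 := pow_le_pow_left₀ (by positivity) h1 2
  rw [mul_pow, Real.sq_sqrt (by positivity), sq_abs] at h2
  have h3 : ‖block y i‖ ^ 2 - 1 / (Δ : ℝ) * c =
      ∑ j, (y (finProdFinEquiv (i, j)) ^ 2 - c / (Δ * B : ℕ)) := by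
    rw [Finset.sum_sub_distrib, EuclideanSpace.norm_sq_eq]
    congr 1
    · simp [block]
    · simp
      field_simp
  rw [h3, one_div_mul_eq_div, div_le_iff₀' hΔ'] at h2
  exact h2

/-! ### Averaging the clipping error over permutations and signs. -/

theorem shtExpectation_eq (D : ℕ) (f : Matrix (Fin D) (Fin D) ℝ → ℝ) :
    shtExpectation D f = (∑ ε : Fin D → ℤˣ, ∑ σ : Equiv.Perm (Fin D), f (sht σ ε)) /
      (Fintype.card (Equiv.Perm (Fin D)) * 2 ^ D) := by
  unfold shtExpectation shtSeed
  rw [Finset.sum_comm, ← Fintype.sum_prod_type' (fun σ ε => f (sht σ ε)), Finset.sum_div]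
  refine Finset.sum_congr rfl fun ω _ => ?_
  simp [PMF.uniformOfFintype_apply, Fintype.card_prod]
  ring

theorem norm_toEuclideanLin_transpose_sub {D : ℕ} {W : Matrix (Fin D) (Fin D) ℝ}
    (hW : Wᵀ * W = 1) (y v : EuclideanSpace ℝ (Fin D)) :
    ‖Matrix.toEuclideanLin Wᵀ y - v‖ = ‖y - Matrix.toEuclideanLin W v‖ := by
  have hW' : W * Wᵀ = 1 := mul_eq_one_comm.1 hW
  have h1 : v = Matrix.toEuclideanLin Wᵀ (Matrix.toEuclideanLin W v) := by
    simp [Matrix.toLpLin_apply, Matrix.mulVec_mulVec, hW]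
  have h2 (u : EuclideanSpace ℝ (Fin D)) : ‖Matrix.toEuclideanLin Wᵀ u‖ = ‖u‖ := by
    have h3 : ‖Matrix.toEuclideanLin Wᵀ u‖ ^ 2 = ‖u‖ ^ 2 := by
      rw [EuclideanSpace.real_norm_sq_eq, EuclideanSpace.real_norm_sq_eq]
      have h4 : (Wᵀ *ᵥ u.ofLp) ⬝ᵥ (Wᵀ *ᵥ u.ofLp) = u.ofLp ⬝ᵥ u.ofLp := by
        rw [Matrix.dotProduct_mulVec, ← Matrix.mulVec_transpose, Matrix.transpose_transpose,
          Matrix.mulVec_mulVec, hW', Matrix.one_mulVec]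
      simpa [dotProduct, sq, Matrix.toLpLin_apply] using h4
    exact (pow_left_inj₀ (norm_nonneg _) (norm_nonneg _) two_ne_zero).1 h3
  rw [← h2 (y - _), map_sub, ← h1]

theorem sum_sq_walshHadamard_mulVec {D m : ℕ} (hD : D = 2 ^ m) (x : Fin D → ℝ) :
    ∑ i, (walshHadamard D *ᵥ x) i ^ 2 = ∑ i, x i ^ 2 := by
  have h : (walshHadamard D *ᵥ x) ⬝ᵥ (walshHadamard D *ᵥ x) = x ⬝ᵥ x := by
    rw [Matrix.dotProduct_mulVec, ← Matrix.mulVec_transpose, walshHadamard_transpose,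
      Matrix.mulVec_mulVec, walshHadamard_mul_self hD, Matrix.one_mulVec]
  simpa [dotProduct, sq] using h

/-- Entries of `H` have square `1 / D`, so the coordinate is a sign sum whose squared coefficients
add up to at most `1 / D`; Khintchine applies. -/
theorem sum_signs_walshHadamard_pow_four_le {D m : ℕ} (hD : D = 2 ^ m) (v : Fin D → ℝ)
    (hv : ∑ j, v j ^ 2 ≤ 1) (i : Fin D) :
    ∑ ε : Fin D → ℤˣ, (walshHadamard D *ᵥ fun j => (((ε j : ℤˣ) : ℤ) : ℝ) * v j) i ^ 4 ≤
      2 ^ D * (3 / (D : ℝ) ^ 2) := by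
  have hD0 : (0 : ℝ) < D := by rw [hD]; positivity
  have h1 (ε : Fin D → ℤˣ) : (walshHadamard D *ᵥ fun j => (((ε j : ℤˣ) : ℤ) : ℝ) * v j) i =
      ∑ j, (((ε j : ℤˣ) : ℤ) : ℝ) * (walshHadamard D i j * v j) := by
    rw [Matrix.mulVec, dotProduct]
    exact Finset.sum_congr rfl fun j _ => mul_left_comm _ _ _
  simp only [h1]
  refine (sum_signs_moments D _).2.trans ?_
  have h2 : ∑ j, (walshHadamard D i j * v j) ^ 2 = (∑ j, v j ^ 2) / D := by
    rw [Finset.sum_div]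
    refine Finset.sum_congr rfl fun j _ => ?_
    rw [walshHadamard_apply hD, mul_pow, div_pow, sq (walshSign _ _ _), walshSign_mul_self,
      Real.sq_sqrt hD0.le]
    ring
  have h3 : (∑ j, v j ^ 2) ^ 2 ≤ 1 := pow_le_one₀ (Finset.sum_nonneg fun _ _ => sq_nonneg _) hv
  rw [h2, div_pow, mul_div_assoc']
  gcongr
  linarith

theorem expectedError_le {m Δ B : ℕ} (h : Δ * B = 2 ^ m)
    (v : EuclideanSpace ℝ (Fin (Δ * B))) (hv : ‖v‖ ≤ 1) : expectedError v ≤ 3 / B := by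
  have hpos : 0 < Δ * B := by rw [h]; positivity
  have hΔ : 0 < Δ := Nat.pos_of_mul_pos_right hpos
  have hB : 0 < B := Nat.pos_of_mul_pos_left hpos
  have hΔ' : (0 : ℝ) < Δ := by exact_mod_cast hΔ
  have hB' : (0 : ℝ) < B := by exact_mod_cast hB
  have hD' : ((Δ * B : ℕ) : ℝ) = Δ * B := by push_cast; rfl
  set c : ℝ := ∑ j, v j ^ 2 with hc
  have hc1 : c ≤ 1 := by
    rw [hc, ← EuclideanSpace.real_norm_sq_eq]
    exact pow_le_one₀ (norm_nonneg _) hv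
  have hc0 : 0 ≤ c := Finset.sum_nonneg fun _ _ => sq_nonneg _
  set N : ℝ := (Fintype.card (Equiv.Perm (Fin (Δ * B))) : ℝ) with hN
  have hN0 : 0 < N := by rw [hN]; exact_mod_cast Fintype.card_pos
  unfold expectedError
  rw [shtExpectation_eq, div_le_iff₀ (by positivity)]
  set z : (Fin (Δ * B) → ℤˣ) → Fin (Δ * B) → ℝ := fun ε =>
    walshHadamard (Δ * B) *ᵥ fun j => (((ε j : ℤˣ) : ℤ) : ℝ) * v j with hz
  have hzs (ε) : ∑ k, z ε k ^ 2 = c := by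
    rw [hz, sum_sq_walshHadamard_mulVec h, hc]
    refine Finset.sum_congr rfl fun j _ => ?_
    rcases Int.units_eq_one_or (ε j) with h | h <;> simp [h]
  -- For fixed signs the vector `z ε` is fixed and only the permutation is random, so the variance
  -- bound for sampling without replacement applies to each block.
  have step (ε : Fin (Δ * B) → ℤˣ) : ∑ σ : Equiv.Perm (Fin (Δ * B)),
      ‖Matrix.toEuclideanLin (sht σ ε)ᵀ (blkclip (Matrix.toEuclideanLin (sht σ ε) v)) - v‖ ^ 2 ≤
        Δ * N * ∑ k, z ε k ^ 4 := by
    have h1 (σ : Equiv.Perm (Fin (Δ * B))) :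
        ‖Matrix.toEuclideanLin (sht σ ε)ᵀ
            (blkclip (Matrix.toEuclideanLin (sht σ ε) v)) - v‖ ^ 2 ≤
          Δ * ∑ i : Fin Δ, (∑ j : Fin B, (z ε (σ (finProdFinEquiv (i, j))) ^ 2 -
            c / (Δ * B : ℕ))) ^ 2 := by
      rw [norm_toEuclideanLin_transpose_sub (sht_transpose_mul_self h σ ε)]
      refine (norm_blkclip_sub_sq_le hΔ hB hc1 _).trans (le_of_eq ?_)
      simp only [Matrix.toLpLin_apply, sht_mulVec, hz]
    refine (Finset.sum_le_sum fun σ _ => h1 σ).trans ?_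
    rw [← Finset.mul_sum, Finset.sum_comm, mul_assoc]
    refine mul_le_mul_of_nonneg_left ?_ hΔ'.le
    have hw0 : ∑ k, (z ε k ^ 2 - c / (Δ * B : ℕ)) = 0 := by
      rw [Finset.sum_sub_distrib, hzs]
      simp
      field_simp
      simp
    -- The variance is at most the raw second moment of the squared coordinates.
    have hw2 : ∑ k, (z ε k ^ 2 - c / (Δ * B : ℕ)) ^ 2 ≤ ∑ k, z ε k ^ 4 := by
      have h2 (k) : (z ε k ^ 2 - c / (Δ * B : ℕ)) ^ 2 = z ε k ^ 4 -
          (c / (Δ * B : ℕ)) * (z ε k ^ 2 - c / (Δ * B : ℕ)) - (c / (Δ * B : ℕ)) * z ε k ^ 2 := by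
        ring
      rw [Finset.sum_congr rfl fun k _ => h2 k, Finset.sum_sub_distrib, Finset.sum_sub_distrib,
        ← Finset.mul_sum, hw0, ← Finset.mul_sum, hzs]
      have : 0 ≤ c / (Δ * B : ℕ) * c := by positivity
      linarith
    have h3 (i : Fin Δ) := sum_perm_sq_sum_le (fun k => z ε k ^ 2 - c / (Δ * B : ℕ)) hw0
      (fun j : Fin B => finProdFinEquiv (i, j))
      (fun j j' hj => (Prod.ext_iff.1 (finProdFinEquiv.injective hj)).2)
    have h4 (i : Fin Δ) : ∑ σ : Equiv.Perm (Fin (Δ * B)),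
        (∑ j : Fin B, (z ε (σ (finProdFinEquiv (i, j))) ^ 2 - c / (Δ * B : ℕ))) ^ 2 ≤
          N * (∑ k, z ε k ^ 4) / Δ := by
      have h5 := h3 i
      rw [Fintype.card_fin, Fintype.card_fin, hD', ← hN] at h5
      rw [le_div_iff₀ hΔ']
      have h6 : N * ∑ k, (z ε k ^ 2 - c / (Δ * B : ℕ)) ^ 2 ≤ N * ∑ k, z ε k ^ 4 :=
        mul_le_mul_of_nonneg_left hw2 hN0.le
      rw [hD'] at h6 ⊢
      nlinarith [h5, h6, hB']
    refine (Finset.sum_le_sum fun i _ => h4 i).trans (le_of_eq ?_)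
    simp
    field_simp
  refine (Finset.sum_le_sum fun ε _ => step ε).trans ?_
  rw [← Finset.mul_sum, Finset.sum_comm]
  have h7 : ∑ k, ∑ ε, z ε k ^ 4 ≤ (Δ * B) * (2 ^ (Δ * B) * (3 / ((Δ : ℝ) * B) ^ 2)) := by
    refine (Finset.sum_le_sum fun k _ =>
      sum_signs_walshHadamard_pow_four_le h v.ofLp hc1 k).trans (le_of_eq ?_)
    simp
  refine (mul_le_mul_of_nonneg_left h7 (by positivity)).trans (le_of_eq ?_)
  field_simp
  rfl

/-- Needed because `log 1 = 0` makes both target bounds vanish. The single block has clipping radius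
1 and norm at most 1, so nothing is clipped. -/
theorem expectedError_eq_zero {Δ B : ℕ} (h : Δ * B = 1)
    (v : EuclideanSpace ℝ (Fin (Δ * B))) (hv : ‖v‖ ≤ 1) : expectedError v = 0 := by
  obtain ⟨rfl, rfl⟩ := mul_eq_one.1 h
  unfold expectedError
  rw [shtExpectation_eq]
  refine div_eq_zero_iff.2 (Or.inl (Finset.sum_eq_zero fun ε _ => Finset.sum_eq_zero fun σ _ => ?_))
  have hW : (sht σ ε)ᵀ * sht σ ε = 1 := sht_transpose_mul_self (m := 0) rfl σ ε
  rw [norm_toEuclideanLin_transpose_sub hW, norm_sq_eq_sum_block]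
  refine Finset.sum_eq_zero fun i _ => ?_
  have h1 : ‖Matrix.toEuclideanLin (sht σ ε) v‖ ≤ 1 := by
    have h2 := norm_toEuclideanLin_transpose_sub hW 0 v
    simp only [map_zero, zero_sub, norm_neg] at h2
    exact h2 ▸ hv
  have h3 : ‖block (Matrix.toEuclideanLin (sht σ ε) v) i‖ ≤ 1 := by
    have h4 := norm_sq_eq_sum_block (Matrix.toEuclideanLin (sht σ ε) v)
    have h5 := Finset.single_le_sum (f := fun i =>
      ‖block (Matrix.toEuclideanLin (sht σ ε) v) i‖ ^ 2) (fun _ _ => sq_nonneg _)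
      (Finset.mem_univ i)
    rw [← h4] at h5
    exact ((pow_le_pow_iff_left₀ (norm_nonneg _) (norm_nonneg _) two_ne_zero).1 h5).trans h1
  rw [block_blkclip_sub, clip, if_pos (by simpa using h3), sub_self, norm_zero]
  norm_num

theorem exists_expectedError_bounds :
    ∃ C : ℝ, 0 < C ∧ ∀ m Δ B : ℕ, Δ * B = 2 ^ m →
      ∀ v : EuclideanSpace ℝ (Fin (Δ * B)), ‖v‖ ≤ 1 →
        expectedError v ≤ C * (Real.log ((Δ * B : ℕ) : ℝ) ^ 2 / (B : ℝ)) ∧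
        expectedError v ≤ C * (Real.log ((Δ * B : ℕ) : ℝ) / Real.sqrt (B : ℝ)) := by
  have hl : 0 < Real.log 2 := Real.log_pos one_lt_two
  have hl1 : Real.log 2 ≤ 1 := Real.log_two_lt_d9.le.trans (by norm_num)
  -- For `D ≥ 2` the constant absorbs the logarithms: `log² D ≥ log² 2`, and `log D ≥ log 2 ≥ log²
  -- 2` as `log 2 ≤ 1`.
  refine ⟨3 / Real.log 2 ^ 2, by positivity, fun m Δ B h v hv => ?_⟩
  rcases Nat.eq_zero_or_pos m with rfl | hm
  · rw [expectedError_eq_zero h v hv, h]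
    simp
  · have hB : 1 ≤ B := Nat.pos_of_mul_pos_left (h ▸ Nat.two_pow_pos m)
    have hB' : (1 : ℝ) ≤ B := by exact_mod_cast hB
    have hB0 : (0 : ℝ) < B := one_pos.trans_le hB'
    have hlog : Real.log 2 ≤ Real.log ((Δ * B : ℕ) : ℝ) := by
      rw [h, Nat.cast_pow, Real.log_pow, Nat.cast_ofNat]
      exact le_mul_of_one_le_left hl.le (by exact_mod_cast hm)
    have hE := expectedError_le h v hv
    refine ⟨hE.trans ?_, hE.trans ?_⟩
    · rw [mul_div_assoc', div_mul_eq_mul_div]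
      gcongr
      rw [le_div_iff₀ (by positivity)]
      gcongr
    · have hs : Real.sqrt B ≤ B := Real.sqrt_le_iff.2 ⟨hB0.le, le_self_pow₀ hB' two_ne_zero⟩
      rw [mul_div_assoc', div_mul_eq_mul_div]
      have : 3 ≤ 3 * Real.log ((Δ * B : ℕ) : ℝ) / Real.log 2 ^ 2 := by
        rw [le_div_iff₀ (by positivity)]
        nlinarith
      gcongr

end SHT
namespace SHT

/-! ### Running programs within a time bound -/

/-- Started in `s`, the program `p` halts within `T` steps in a memory satisfying `Q`. -/
def Reaches (p : Prog) (s : Mem) (T : ℕ) (Q : Mem → Prop) : Prop :=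
  ∃ (t : ℕ) (s' : Mem), Exec p s t s' ∧ t ≤ T ∧ Q s'

theorem Reaches.mono {p : Prog} {s : Mem} {T T' : ℕ} {Q R : Mem → Prop} (hp : Reaches p s T Q)
    (hT : T ≤ T') (hQ : ∀ s, Q s → R s) : Reaches p s T' R := by
  obtain ⟨t, s', e, h, hq⟩ := hp
  exact ⟨t, s', e, h.trans hT, hQ s' hq⟩

theorem Reaches.seq {p q : Prog} {s : Mem} {T₁ T₂ : ℕ} {Q R : Mem → Prop}
    (hp : Reaches p s T₁ Q) (hq : ∀ s, Q s → Reaches q s T₂ R) :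
    Reaches (.seq p q) s (T₁ + T₂) R := by
  obtain ⟨t₁, s₁, e₁, h₁, hQ⟩ := hp
  obtain ⟨t₂, s₂, e₂, h₂, hR⟩ := hq s₁ hQ
  exact ⟨_, s₂, .seq e₁ e₂, add_le_add h₁ h₂, hR⟩

/-- A loop whose invariant `I` counts the rounds up to `n`. -/
theorem Reaches.while {x y n c : ℕ} {p : Prog} {I : ℕ → Mem → Prop}
    (hlt : ∀ i s, i < n → I i s → s.idx x < s.idx y) (hend : ∀ s, I n s → ¬ s.idx x < s.idx y)
    (hbody : ∀ i s, i < n → I i s → Reaches p s c (I (i + 1))) {s : Mem} (h0 : I 0 s) :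
    Reaches (.while x y p) s (n * (c + 1) + 1) (I n) := by
  suffices h : ∀ k i s, i + k = n → I i s →
      Reaches (.while x y p) s (k * (c + 1) + 1) (I n) from h n 0 s (zero_add n) h0
  intro k
  induction k with
  | zero =>
    intro i s hi hI
    obtain rfl : i = n := hi
    exact ⟨1, s, .while_false (hend s hI), by omega, hI⟩
  | succ k ih =>
    intro i s hi hI
    have hin : i < n := by omega
    obtain ⟨t₁, s₁, e₁, h₁, hI₁⟩ := hbody i s hin hI
    obtain ⟨t₂, s₂, e₂, h₂, hI₂⟩ := ih (i + 1) s₁ (by omega) hI₁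
    refine ⟨_, s₂, .while_true (hlt i s hin hI) e₁ e₂, ?_, hI₂⟩
    rw [Nat.succ_mul]
    omega

/-- Straight-line code. The empty code is a loop that is never entered. -/
def straight : List Instr → Prog
  | [] => .while 0 0 (.instr (.iconst 0 0))
  | a :: l => .seq (.instr a) (straight l)

/-- The effect of straight-line code on the memory. -/
noncomputable def runList : List Instr → Mem → Mem
  | [], s => s
  | a :: l, s => runList l (a.run s)

theorem Reaches.straight (l : List Instr) {s : Mem} {Q : Mem → Prop} (h : Q (runList l s)) :
    Reaches (straight l) s (l.length + 1) Q := by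
  suffices h' : Exec (SHT.straight l) s (l.length + 1) (runList l s) from ⟨_, _, h', le_rfl, h⟩
  clear h
  induction l generalizing s with
  | nil => exact .while_false (lt_irrefl _)
  | cons a l ih =>
    rw [List.length_cons, add_comm l.length, add_assoc]
    exact .seq (.instr a s) ih

theorem Reaches.while_straight {x y n : ℕ} (l : List Instr) {I : ℕ → Mem → Prop}
    (hlt : ∀ i s, i < n → I i s → s.idx x < s.idx y) (hend : ∀ s, I n s → ¬ s.idx x < s.idx y)
    (hbody : ∀ i s, i < n → I i s → I (i + 1) (runList l s)) {s : Mem} (h0 : I 0 s) :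
    Reaches (.while x y (SHT.straight l)) s (n * (l.length + 2) + 1) (I n) :=
  Reaches.while hlt hend (fun i s hi hI => Reaches.straight l (hbody i s hi hI)) h0

/-! ### The fast Walsh–Hadamard transform in constant geometry -/

/-- One stage of the transform of a vector of length `2 h`. -/
def butterfly (h : ℕ) (a : ℕ → ℝ) (u : ℕ) : ℝ :=
  if u < h then a (2 * u) + a (2 * u + 1) else a (2 * (u - h)) - a (2 * (u - h) + 1)

/-- After `k` stages, position `2 ^ r * b + i` holds coefficient `b` of the transform of the `i`-th
block of length `2 ^ k`. Equal coefficients of blocks `2 i` and `2 i + 1` are then adjacent, and the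
next butterfly merges these blocks. -/
theorem iterate_butterfly_apply {n k : ℕ} (x : ℕ → ℝ) {r : ℕ} (hkr : k + r = n + 1) {i b : ℕ}
    (hi : i < 2 ^ r) (hb : b < 2 ^ k) :
    (butterfly (2 ^ n))^[k] x (2 ^ r * b + i) =
      ∑ j ∈ Finset.range (2 ^ k), walshSign k b j * x (2 ^ k * i + j) := by
  induction k generalizing r i b with
  | zero =>
    obtain rfl : b = 0 := by simpa using hb
    simp
  | succ k ih =>
    have hn : n = r + k := by omega
    have ih' (b i : ℕ) (hb : b < 2 ^ k) (hi : i < 2 ^ (r + 1)) :=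
      ih (r := r + 1) (by omega) hi hb
    rw [Function.iterate_succ_apply', butterfly, sum_range_two_pow_succ]
    have hsplit : 2 ^ n = 2 ^ r * 2 ^ k := by rw [hn, pow_add]
    have hr : 2 ^ (r + 1) = 2 * 2 ^ r := by rw [pow_succ]; ring
    have hk : 2 ^ (k + 1) = 2 * 2 ^ k := by rw [pow_succ]; ring
    have e0 (b : ℕ) : 2 * (2 ^ r * b + i) = 2 ^ (r + 1) * b + 2 * i := by rw [hr]; ring
    -- The new top digit `c` of the coefficient index decides between the sum and the difference
    -- branch.
    obtain ⟨c, b, hb', rfl, hc⟩ : ∃ c b', b' < 2 ^ k ∧ b = 2 ^ k * c + b' ∧ c < 2 :=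
      ⟨b / 2 ^ k, b % 2 ^ k, Nat.mod_lt _ (by positivity), (Nat.div_add_mod _ _).symm,
        Nat.div_lt_of_lt_mul (by rw [mul_comm, ← hk]; exact hb)⟩
    have e1 : ∀ j ∈ Finset.range (2 ^ k), walshSign (k + 1) (2 ^ k * c + b) j =
        walshSign k b j := fun j hj => by
      have := walshSign_two_pow_mul_add c 0 hb' (Finset.mem_range.1 hj)
      simpa using this
    have e2 : ∀ j ∈ Finset.range (2 ^ k), walshSign (k + 1) (2 ^ k * c + b) (2 ^ k * 1 + j) =
        walshSign k b j * if c.testBit 0 = true then -1 else 1 := fun j hj => by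
      have := walshSign_two_pow_mul_add c 1 hb' (Finset.mem_range.1 hj)
      simpa using this
    have f1 (j : ℕ) : 2 ^ (k + 1) * i + j = 2 ^ k * (2 * i) + j := by rw [hk]; ring
    have f2 (j : ℕ) : 2 ^ (k + 1) * i + (2 ^ k * 1 + j) = 2 ^ k * (2 * i + 1) + j := by
      rw [hk]; ring
    have s1 : ∑ j ∈ Finset.range (2 ^ k), walshSign (k + 1) (2 ^ k * c + b) j *
        x (2 ^ (k + 1) * i + j) =
          ∑ j ∈ Finset.range (2 ^ k), walshSign k b j * x (2 ^ k * (2 * i) + j) :=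
      Finset.sum_congr rfl fun j hj => by rw [e1 j hj, f1]
    have s2 : ∑ j ∈ Finset.range (2 ^ k), walshSign (k + 1) (2 ^ k * c + b) (2 ^ k * 1 + j) *
        x (2 ^ (k + 1) * i + (2 ^ k * 1 + j)) =
          (∑ j ∈ Finset.range (2 ^ k), walshSign k b j * x (2 ^ k * (2 * i + 1) + j)) *
            if c.testBit 0 = true then -1 else 1 := by
      rw [Finset.sum_mul]
      exact Finset.sum_congr rfl fun j hj => by rw [e2 j hj, f2]; ring
    rw [s1, s2]
    clear s1 s2 e1 e2
    have hlt : 2 ^ r * b + i < 2 ^ n := by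
      rw [hsplit]
      calc 2 ^ r * b + i < 2 ^ r * b + 2 ^ r := by omega
        _ = 2 ^ r * (b + 1) := by ring
        _ ≤ 2 ^ r * 2 ^ k := Nat.mul_le_mul_left _ hb'
    have g0 := ih' b (2 * i) hb' (by omega)
    have g1 := ih' b (2 * i + 1) hb' (by omega)
    interval_cases c
    · rw [mul_zero, zero_add, if_pos hlt, e0, add_assoc, g0, g1]
      simp
    · have e3 : 2 ^ r * (2 ^ k * 1 + b) + i = 2 ^ n + (2 ^ r * b + i) := by rw [hsplit]; ring
      rw [e3, if_neg (by omega), Nat.add_sub_cancel_left, e0, add_assoc, g0, g1]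
      simp [sub_eq_add_neg]

theorem iterate_butterfly (m : ℕ) (x : ℕ → ℝ) {b : ℕ} (hb : b < 2 ^ m) :
    (butterfly (2 ^ m / 2))^[m] x b =
      ∑ j ∈ Finset.range (2 ^ m), walshSign m b j * x j := by
  cases m with
  | zero =>
    obtain rfl : b = 0 := by simpa using hb
    simp
  | succ n =>
    rw [pow_succ, Nat.mul_div_cancel _ two_pos, ← pow_succ]
    have := iterate_butterfly_apply (n := n) (k := n + 1) (r := 0) x (by omega) (i := 0) (by simp) hb
    simpa using this

/-! ### The programs -/

/-- The contents that the loops below leave alone: `D`, the constant `1`, half the order, and the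
input arrays. -/
structure Ready (D g : ℕ) (P : ℕ → ℕ) (X E : ℕ → ℝ) (s : Mem) : Prop where
  order : s.idx 0 = D
  one : s.idx 1 = 1
  half : s.idx 2 = D / 2
  size : s.idx 3 = g
  perm : s.idxArr 0 = P
  vec : s.valArr 0 = X
  signs : s.valArr 1 = E

/-- Index register `1` becomes `1`, index register `2` half the order, and index register
`3` the order. -/
def setupProg : Prog :=
  .seq (straight [.iconst 1 1, .iconst 2 0, .iconst 3 1])
    -- Halving by doubling: register 2 trails register 3 by one doubling. Subtracting register 4
    -- from itself makes a zero, which turns the next addition into a copy.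
    (.while 3 0 (straight [.isub 4 4 4, .iadd 2 3 4, .iadd 3 3 3]))

theorem setupProg_reaches {m D : ℕ} (hD : D = 2 ^ m) {s : Mem} (hs : s.idx 0 = D) :
    Reaches setupProg s (5 * m + 5) (Ready D D (s.idxArr 0) (s.valArr 0) (s.valArr 1)) := by
  have h := (Reaches.straight [.iconst 1 1, .iconst 2 0, .iconst 3 1] (s := s)
    (Q := fun t => t.idx 0 = D ∧ t.idx 1 = 1 ∧ t.idx 2 = 2 ^ 0 / 2 ∧ t.idx 3 = 2 ^ 0 ∧
      t.idxArr = s.idxArr ∧ t.valArr = s.valArr)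
    (by simp [runList, Instr.run, hs])).seq
    fun t ht => Reaches.while_straight (x := 3) (y := 0) (n := m)
      [.isub 4 4 4, .iadd 2 3 4, .iadd 3 3 3]
      (I := fun i t => t.idx 0 = D ∧ t.idx 1 = 1 ∧ t.idx 2 = 2 ^ i / 2 ∧ t.idx 3 = 2 ^ i ∧
        t.idxArr = s.idxArr ∧ t.valArr = s.valArr)
      (fun i t hi hI => by
        rw [hI.1, hI.2.2.2.1, hD]; exact Nat.pow_lt_pow_right (by norm_num) hi)
      (fun t hI => by rw [hI.1, hI.2.2.2.1, hD]; exact lt_irrefl _)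
      (fun i t _ hI => by
        obtain ⟨h0, h1, h2, h3, h4, h5⟩ := hI
        simp [runList, Instr.run, h0, h1, h3, h4, h5, pow_succ]
        omega) ht
  refine h.mono (by simp; omega) fun t ⟨h0, h1, h2, h3, h4, h5⟩ => ?_
  exact ⟨h0, h1, by rw [h2, hD], by rw [h3, hD], by rw [h4], by rw [h5], by rw [h5]⟩

/-- A loop of index register `4` over `0, …, D - 1`. -/
def forProg (l : List Instr) : Prog :=
  .seq (straight [.iconst 4 0]) (.while 4 0 (straight (l ++ [.iadd 4 4 1])))

theorem runList_append (l l' : List Instr) (s : Mem) :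
    runList (l ++ l') s = runList l' (runList l s) := by
  induction l generalizing s with
  | nil => rfl
  | cons a l ih => exact ih _

/-- The invariant `J` sees only real registers and real arrays, so index registers from 5 on are
scratch space. Each round costs the code, the increment, the empty tail and the test. -/
theorem forProg_reaches {D g : ℕ} {P : ℕ → ℕ} {X E : ℕ → ℝ} (l : List Instr)
    {J : ℕ → (ℕ → ℝ) → (ℕ → ℕ → ℝ) → Prop} {s : Mem} (hs : Ready D g P X E s)
    (h0 : J 0 s.val s.valArr)
    (hbody : ∀ i t, i < D → Ready D g P X E t → t.idx 4 = i → J i t.val t.valArr →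
      Ready D g P X E (runList l t) ∧ (runList l t).idx 4 = i ∧
        J (i + 1) (runList l t).val (runList l t).valArr) :
    Reaches (forProg l) s (D * (l.length + 3) + 3)
      fun t => Ready D g P X E t ∧ J D t.val t.valArr := by
  have h := (Reaches.straight [.iconst 4 0] (s := s)
    (Q := fun t => Ready D g P X E t ∧ t.idx 4 = 0 ∧ J 0 t.val t.valArr)
    (by
      obtain ⟨a, b, c, d, e, f, k⟩ := hs
      exact ⟨by constructor <;> simpa [runList, Instr.run, Function.update_apply],
        by simp [runList, Instr.run], h0⟩)).seq
    fun t ht => Reaches.while_straight (x := 4) (y := 0) (n := D) (l ++ [.iadd 4 4 1])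
      (I := fun i t => Ready D g P X E t ∧ t.idx 4 = i ∧ J i t.val t.valArr)
      (fun i t hi hI => by rw [hI.1.order, hI.2.1]; exact hi)
      (fun t hI => by rw [hI.1.order, hI.2.1]; exact lt_irrefl _)
      (fun i t hi hI => by
        obtain ⟨⟨a, b, c, d, e, f, k⟩, h4, hJ⟩ := hbody i t hi hI.1 hI.2.1 hI.2.2
        rw [runList_append]
        exact ⟨by constructor <;> simpa [runList, Instr.run, Function.update_apply],
          by simp [runList, Instr.run, h4, b], hJ⟩) ht
  exact h.mono (by simp; ring_nf; omega) fun t ht => ⟨ht.1, ht.2.2⟩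

/-- The code of one butterfly of a stage, from real array `3` to real array `4`. -/
def butterflyCode : List Instr :=
  [.iadd 5 4 4, .iadd 6 5 1, .iadd 7 4 2, .rload 0 3 5, .rload 1 3 6, .radd 2 0 1, .rsub 3 0 1,
    .rstore 4 4 2, .rstore 4 7 3, .iadd 4 4 1]

/-- One stage of the transform, on real array `3`. -/
def stageProg : Prog :=
  .seq (straight [.iconst 4 0])
    (.seq (.while 4 2 (straight butterflyCode)) (forProg [.rload 0 4 4, .rstore 3 4 0]))

theorem stageProg_reaches {D : ℕ} (hD : D = 2 * (D / 2)) {P : ℕ → ℕ} {X E a : ℕ → ℝ}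
    {s : Mem} (hs : Ready D g P X E s) (ha : ∀ i < D, s.valArr 3 i = a i) :
    Reaches stageProg s (17 * D + 6) fun t => Ready D g P X E t ∧
      (∀ i < D, t.valArr 3 i = butterfly (D / 2) a i) := by
  have h := (Reaches.straight [.iconst 4 0] (s := s)
    (Q := fun t => Ready D g P X E t ∧ t.idx 4 = 0 ∧ t.valArr 3 = s.valArr 3 ∧
      ∀ j < 0, t.valArr 4 j = a (2 * j) + a (2 * j + 1) ∧
        t.valArr 4 (j + D / 2) = a (2 * j) - a (2 * j + 1))
    (by
      obtain ⟨a, b, c, d, e, f, k⟩ := hs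
      exact ⟨by constructor <;> simpa [runList, Instr.run, Function.update_apply],
        by simp [runList, Instr.run], rfl, by simp⟩)).seq
    fun t ht => (Reaches.while_straight (x := 4) (y := 2) (n := D / 2) butterflyCode
      (I := fun i t => Ready D g P X E t ∧ t.idx 4 = i ∧ t.valArr 3 = s.valArr 3 ∧
        ∀ j < i, t.valArr 4 j = a (2 * j) + a (2 * j + 1) ∧
          t.valArr 4 (j + D / 2) = a (2 * j) - a (2 * j + 1))
      (fun i t hi hI => by rw [hI.1.half, hI.2.1]; exact hi)
      (fun t hI => by rw [hI.1.half, hI.2.1]; exact lt_irrefl _)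
      (fun i t hi hI => by
        obtain ⟨⟨b, c, d, e, f, k, l⟩, h4, h3, hJ⟩ := hI
        have a0 := ha (2 * i) (by omega)
        have a1 := ha (2 * i + 1) (by omega)
        refine ⟨?_, ?_, ?_, ?_⟩
        · constructor <;> simpa [butterflyCode, runList, Instr.run, writeArr, Function.update_apply]
        · simp [butterflyCode, runList, Instr.run, h4, c]
        · simp [butterflyCode, runList, Instr.run, writeArr, h3]
        · intro j hj
          -- Sums and differences go to different halves of array 4, so the two stores never
          -- collide.
          have hne : j ≠ i + D / 2 := by omega
          simp [butterflyCode, runList, Instr.run, writeArr, Function.update_apply, h4, c, d,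
            ← two_mul, h3, a0, a1, hne]
          rcases Nat.lt_succ_iff_lt_or_eq.1 hj with hj | rfl
          · have hne' : j + D / 2 ≠ i := by omega
            simp [hj.ne, hne', hJ j hj]
          · simp) ht).seq
    fun t ⟨ht, h4, h3, hJ⟩ => Reaches.mono (T' := D * 5 + 3)
      (R := fun u => Ready D g P X E u ∧ ∀ i < D, u.valArr 3 i = butterfly (D / 2) a i)
      (forProg_reaches [.rload 0 4 4, .rstore 3 4 0]
      (J := fun i _ V => V 4 = t.valArr 4 ∧ ∀ j < i, V 3 j = t.valArr 4 j) ht ⟨rfl, by simp⟩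
      (fun i u hi ⟨b, c, d, e, f, k, l⟩ hu hJ => by
        refine ⟨?_, ?_, ?_, ?_⟩
        · constructor <;> simpa [runList, Instr.run, writeArr, Function.update_apply]
        · simp [runList, Instr.run, hu]
        · simp [runList, Instr.run, writeArr, hJ.1]
        · intro j hj
          simp [runList, Instr.run, writeArr, hu, Function.update_apply]
          rcases Nat.lt_succ_iff_lt_or_eq.1 hj with hj | rfl
          · simp [hj.ne, hJ.2 j hj]
          · simp [hJ.1])) le_rfl fun u hu => ⟨hu.1, fun i hi => by
        rw [hu.2.2 i hi, butterfly]
        split_ifs with hlt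
        · exact (hJ i hlt).1
        · have := (hJ (i - D / 2) (by omega)).2
          rwa [Nat.sub_add_cancel (not_lt.1 hlt)] at this⟩
  exact h.mono (by simp [butterflyCode]; omega) fun _ h => h

/-- The unnormalized transform of real array `3`, in place. -/
def unnormalizedProg : Prog :=
  .seq (straight [.iconst 3 1]) (.while 3 0 (.seq stageProg (straight [.iadd 3 3 3])))

/-- Register 3 doubles from 1 up to `D`, which counts the `m` stages without computing a logarithm;
its initial content `g` is irrelevant. -/
theorem unnormalizedProg_reaches {m D g : ℕ} (hD : D = 2 ^ m) {P : ℕ → ℕ} {X E a : ℕ → ℝ}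
    {s : Mem} (hs : Ready D g P X E s) (ha : ∀ i < D, s.valArr 3 i = a i) :
    Reaches unnormalizedProg s (m * (17 * D + 9) + 3) fun t => Ready D D P X E t ∧
      ∀ i < D, t.valArr 3 i = ∑ j ∈ Finset.range (2 ^ m), walshSign m i j * a j := by
  have h := (Reaches.straight [.iconst 3 1] (s := s)
    (Q := fun t => Ready D (2 ^ 0) P X E t ∧
      ∀ i < D, t.valArr 3 i = (butterfly (D / 2))^[0] a i)
    (by
      obtain ⟨a, b, c, d, e, f, k⟩ := hs
      exact ⟨by constructor <;> simp [runList, Instr.run, *], ha⟩)).seq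
    fun t ht => Reaches.while (x := 3) (y := 0) (n := m)
      (p := .seq stageProg (straight [.iadd 3 3 3])) (c := 17 * D + 6 + 2)
      (I := fun i t => Ready D (2 ^ i) P X E t ∧
        ∀ j < D, t.valArr 3 j = (butterfly (D / 2))^[i] a j)
      (fun i t hi hI => by
        rw [hI.1.order, hI.1.size, hD]; exact Nat.pow_lt_pow_right (by norm_num) hi)
      (fun t hI => by rw [hI.1.order, hI.1.size, hD]; exact lt_irrefl _)
      (fun i t hi hI => by
        have hD2 : D = 2 * (D / 2) := by
          obtain ⟨n, rfl⟩ : ∃ n, m = n + 1 := ⟨m - 1, by omega⟩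
          rw [pow_succ] at hD
          omega
        refine (stageProg_reaches hD2 hI.1 hI.2).seq fun u hu => Reaches.straight _ ?_
        obtain ⟨⟨b, c, d, e, f, k, l⟩, hv⟩ := hu
        refine ⟨?_, fun j hj => ?_⟩
        · constructor <;> simp [runList, Instr.run, *]
          ring
        · rw [Function.iterate_succ_apply']
          exact hv j hj) ht
  refine h.mono (by simp; ring_nf; omega) fun t ⟨ht, hv⟩ => ⟨hD ▸ ht, fun i hi => ?_⟩
  rw [hv i hi, hD, iterate_butterfly m a (hD ▸ hi)]

/-- The orthonormal transform of real array `3`, in place. -/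
def hadamardProg : Prog :=
  .seq unnormalizedProg (.seq (straight [.rconst 4 0, .rconst 5 1]) (.seq (forProg [.radd 4 4 5])
    (.seq (straight [.rsqrt 4 4]) (forProg [.rload 0 3 4, .rdiv 0 0 4, .rstore 3 4 0]))))

/-- No instruction converts an index to a real, so `D` is obtained as a real by adding 1 in a loop
of `D` rounds before the square root is taken. -/
theorem hadamardProg_reaches {m D g : ℕ} (hD : D = 2 ^ m) {P : ℕ → ℕ} {X E : ℕ → ℝ}
    {x : Fin D → ℝ} {s : Mem} (hs : Ready D g P X E s) (hx : ∀ i : Fin D, s.valArr 3 i = x i) :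
    Reaches hadamardProg s (m * (17 * D + 9) + 10 * D + 14) fun t => Ready D D P X E t ∧
      ∀ i : Fin D, t.valArr 3 i = (walshHadamard D *ᵥ x) i := by
  set a : ℕ → ℝ := s.valArr 3
  obtain rfl : (fun i : Fin D => a i) = x := funext hx
  set c : ℕ → ℝ := fun i => ∑ j ∈ Finset.range (2 ^ m), walshSign m i j * a j
  have h := (unnormalizedProg_reaches hD hs (a := a) fun _ _ => rfl).seq fun t ⟨ht, hv⟩ =>
    (Reaches.straight [.rconst 4 0, .rconst 5 1] (s := t)
      (Q := fun t => Ready D D P X E t ∧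
        (fun (i : ℕ) (v : ℕ → ℝ) (V : ℕ → ℕ → ℝ) =>
          v 4 = i ∧ v 5 = 1 ∧ ∀ j < D, V 3 j = c j) 0 t.val t.valArr)
      (by
        obtain ⟨b, c, d, e, f, k, l⟩ := ht
        refine ⟨by constructor <;> simpa [runList, Instr.run], ?_, ?_, hv⟩ <;>
          simp [runList, Instr.run])).seq
    fun t ⟨ht, hv⟩ => (forProg_reaches [.radd 4 4 5]
      (J := fun (i : ℕ) (v : ℕ → ℝ) (V : ℕ → ℕ → ℝ) =>
          v 4 = i ∧ v 5 = 1 ∧ ∀ j < D, V 3 j = c j) ht hv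
      (fun i u hi ⟨b, c, d, e, f, k, l⟩ hu ⟨h4, h5, hJ⟩ => by
        refine ⟨?_, ?_, ?_, ?_, ?_⟩
        · constructor <;> simpa [runList, Instr.run]
        · simp [runList, Instr.run, hu]
        · simp [runList, Instr.run, h4, h5]
        · simp [runList, Instr.run, h5]
        · simpa [runList, Instr.run] using hJ)).seq
    fun t ⟨ht, h4, h5, hv⟩ => (Reaches.straight [.rsqrt 4 4] (s := t)
      (Q := fun t => Ready D D P X E t ∧ t.val 4 = Real.sqrt D ∧ ∀ j < D, t.valArr 3 j = c j)
      (by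
        obtain ⟨b, c, d, e, f, k, l⟩ := ht
        refine ⟨by constructor <;> simpa [runList, Instr.run], ?_, hv⟩
        simp [runList, Instr.run, h4])).seq
    fun t ⟨ht, h4, hv⟩ => forProg_reaches [.rload 0 3 4, .rdiv 0 0 4, .rstore 3 4 0]
      (J := fun i v V => v 4 = Real.sqrt D ∧ (∀ j < i, V 3 j = c j / Real.sqrt D) ∧
        ∀ j < D, i ≤ j → V 3 j = c j) ht ⟨h4, by simp, fun j hj _ => hv j hj⟩
      (fun i u hi ⟨b, c, d, e, f, k, l⟩ hu ⟨h4, h5, hJ⟩ => by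
        refine ⟨?_, ?_, ?_, ?_, ?_⟩
        · constructor <;> simpa [runList, Instr.run, writeArr, Function.update_apply]
        · simp [runList, Instr.run, hu]
        · simp [runList, Instr.run, h4]
        · intro j hj
          simp [runList, Instr.run, writeArr, hu, h4, Function.update_apply]
          rcases Nat.lt_succ_iff_lt_or_eq.1 hj with hj | rfl
          · simp [hj.ne, h5 j hj]
          · simp [hJ j hi le_rfl]
        · intro j hj hij
          have hne : j ≠ i := by omega
          simp [runList, Instr.run, writeArr, hu, hne, hJ j hj (by omega)])
  refine h.mono (by simp; ring_nf; omega) fun t ⟨ht, _, hv, _⟩ => ⟨ht, fun i => ?_⟩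
  rw [hv i i.2, walshHadamard_mulVec hD a i]

/-- The two programs: a loop with body `load` fills real array `3`, the transform is applied, and a
loop with body `store` writes the result. -/
def conjugatedProg (load store : List Instr) : Prog :=
  .seq setupProg (.seq (forProg load) (.seq hadamardProg (forProg store)))

/-- The hypothesis reads `17 D m + 14 m + (16 + a + b) D + 25`. Each of `m`, `D`, `1` is at most `D
m`, and `17 + 14 + 16 + 25 = 72`. -/
theorem conjugatedProg_bound {m D t a b : ℕ} (hD : D = 2 ^ m) (h2 : 2 ≤ D)
    (ht : t ≤ 5 * m + 5 + (D * (a + 3) + 3 + (m * (17 * D + 9) + 10 * D + 14 + (D * (b + 3) + 3)))) :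
    (t : ℝ) ≤ ((a + b + 72 : ℕ) : ℝ) / Real.log 2 * (D * Real.log D) := by
  have hm : 1 ≤ m := by
    by_contra hm
    obtain rfl : m = 0 := by omega
    omega
  have hl : 0 < Real.log 2 := Real.log_pos one_lt_two
  have h1 : t ≤ (a + b + 72) * (D * m) := by
    have hDm : D ≤ D * m := Nat.le_mul_of_pos_right _ hm
    have hmm : m ≤ D * m := Nat.le_mul_of_pos_left _ (by omega)
    have ha : D * a ≤ D * m * a := Nat.mul_le_mul_right _ hDm
    have hb : D * b ≤ D * m * b := Nat.mul_le_mul_right _ hDm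
    nlinarith
  have h3 : Real.log D = m * Real.log 2 := by rw [hD, Nat.cast_pow, Real.log_pow, Nat.cast_ofNat]
  rw [h3]
  have h4 : ((a + b + 72 : ℕ) : ℝ) / Real.log 2 * (D * (m * Real.log 2)) =
      (((a + b + 72) * (D * m) : ℕ) : ℝ) := by
    push_cast
    field_simp
  rw [h4]
  exact_mod_cast h1

/-- Signs are applied on loading; the permutation is a gather through `σ` on storing. -/
theorem exists_multipliesWithin : ∃ (p : Prog) (K : ℝ), MultipliesWithin (fun W => W) p K := by
  refine ⟨conjugatedProg [.rload 0 0 4, .rload 1 1 4, .rmul 0 1 0, .rstore 3 4 0]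
    [.iload 5 0 4, .rload 0 3 5, .rstore 2 4 0], (4 + 3 + 72 : ℕ) / Real.log 2,
    fun m D hD σ ε x s hs => ?_⟩
  obtain ⟨t, s', e, ht, -, hv⟩ := (setupProg_reaches hD hs.1).seq fun t ht =>
    (forProg_reaches [.rload 0 0 4, .rload 1 1 4, .rmul 0 1 0, .rstore 3 4 0]
      (J := fun i _ V => ∀ j < i, V 3 j = s.valArr 1 j * s.valArr 0 j) ht (by simp)
      (fun i u hi ⟨b, c, d, e, f, k, l⟩ hu hJ => by
        refine ⟨?_, ?_, ?_⟩
        · constructor <;> simpa [runList, Instr.run, writeArr, Function.update_apply]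
        · simp [runList, Instr.run, hu]
        · intro j hj
          simp [runList, Instr.run, writeArr, hu, k, l, Function.update_apply]
          rcases Nat.lt_succ_iff_lt_or_eq.1 hj with hj | rfl
          · simp [hj.ne, hJ j hj]
          · simp)).seq
    fun t ⟨ht, hv⟩ => (hadamardProg_reaches hD ht
      (x := fun j => (((ε j : ℤˣ) : ℤ) : ℝ) * x j)
      (fun i => by rw [hv i i.2, (hs.2 i).2.1, (hs.2 i).2.2])).seq
    fun t ⟨ht, hv⟩ => forProg_reaches [.iload 5 0 4, .rload 0 3 5, .rstore 2 4 0]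
      (J := fun i _ V => (∀ j : Fin D, V 3 j =
          (walshHadamard D *ᵥ fun j => (((ε j : ℤˣ) : ℤ) : ℝ) * x j) j) ∧
        ∀ j : Fin D, (j : ℕ) < i → V 2 j = (sht σ ε *ᵥ x) j) ht ⟨hv, by simp⟩
      (fun i u hi ⟨b, c, d, e, f, k, l⟩ hu ⟨h3, hJ⟩ => by
        have hσ := (hs.2 ⟨i, hi⟩).1
        refine ⟨?_, ?_, ?_, ?_⟩
        · constructor <;> simpa [runList, Instr.run, writeArr, Function.update_apply]
        · simp [runList, Instr.run, hu]
        · simpa [runList, Instr.run, writeArr] using h3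
        · intro j hj
          simp [runList, Instr.run, writeArr, hu, f, Function.update_apply]
          rcases Nat.lt_succ_iff_lt_or_eq.1 hj with hj | rfl
          · simp [hj.ne, hJ j hj]
          · simp only [Fin.eta] at hσ
            simp [hσ, h3, sht_mulVec])
  exact ⟨t, s', e, fun i => hv.2 i i.2, fun h2 => conjugatedProg_bound (a := 4) (b := 3) hD h2 ht⟩

/-- Loading scatters `x j` to cell `σ j`, which realizes the inverse permutation without computing
it; signs come last. -/
theorem exists_multipliesWithin_transpose :
    ∃ (p : Prog) (K : ℝ), MultipliesWithin (fun W => Matrix.transpose W) p K := by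
  refine ⟨conjugatedProg [.iload 5 0 4, .rload 0 0 4, .rstore 3 5 0]
    [.rload 0 3 4, .rload 1 1 4, .rmul 0 1 0, .rstore 2 4 0], (3 + 4 + 72 : ℕ) / Real.log 2,
    fun m D hD σ ε x s hs => ?_⟩
  obtain ⟨t, s', e, ht, -, hv⟩ := (setupProg_reaches hD hs.1).seq fun t ht =>
    (forProg_reaches [.iload 5 0 4, .rload 0 0 4, .rstore 3 5 0]
      (J := fun i _ V => ∀ j : Fin D, (j : ℕ) < i → V 3 (σ j) = x j) ht (by simp)
      (fun i u hi ⟨b, c, d, e, f, k, l⟩ hu hJ => by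
        have hσ := (hs.2 ⟨i, hi⟩).1
        have hx := (hs.2 ⟨i, hi⟩).2.1
        refine ⟨?_, ?_, ?_⟩
        · constructor <;> simpa [runList, Instr.run, writeArr, Function.update_apply]
        · simp [runList, Instr.run, hu]
        · intro j hj
          simp only at hσ hx
          simp [runList, Instr.run, writeArr, hu, f, k, hσ, hx, Function.update_apply]
          rcases Nat.lt_succ_iff_lt_or_eq.1 hj with hj | rfl
          -- Injectivity of `σ` keeps later scatter writes off the cells already filled.
          · have hne : (σ j : ℕ) ≠ σ ⟨i, hi⟩ := fun h => hj.ne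
              (congrArg Fin.val (σ.injective (Fin.ext h)))
            rw [if_neg (by simpa [Fin.ext_iff] using hne), hJ j hj]
          · simp)).seq
    fun t ⟨ht, hv⟩ => (hadamardProg_reaches hD ht (x := fun j => x (σ.symm j))
      (fun i => by
        have := hv (σ.symm i) (Fin.is_lt _)
        rwa [Equiv.apply_symm_apply] at this)).seq
    fun t ⟨ht, hv⟩ => forProg_reaches [.rload 0 3 4, .rload 1 1 4, .rmul 0 1 0, .rstore 2 4 0]
      (J := fun i _ V => (∀ j : Fin D, V 3 j = (walshHadamard D *ᵥ fun j => x (σ.symm j)) j) ∧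
        ∀ j : Fin D, (j : ℕ) < i → V 2 j = ((sht σ ε)ᵀ *ᵥ x) j) ht ⟨hv, by simp⟩
      (fun i u hi ⟨b, c, d, e, f, k, l⟩ hu ⟨h3, hJ⟩ => by
        have hε := (hs.2 ⟨i, hi⟩).2.2
        have h3i := h3 ⟨i, hi⟩
        refine ⟨?_, ?_, ?_, ?_⟩
        · constructor <;> simpa [runList, Instr.run, writeArr, Function.update_apply]
        · simp [runList, Instr.run, hu]
        · simpa [runList, Instr.run, writeArr] using h3
        · intro j hj
          simp only at hε h3i
          simp [runList, Instr.run, writeArr, hu, l, hε, h3i, Function.update_apply]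
          rcases Nat.lt_succ_iff_lt_or_eq.1 hj with hj | rfl
          · simp [hj.ne, hJ j hj]
          · simp [sht_transpose_mulVec])
  exact ⟨t, s', e, fun i => hv.2 i i.2, fun h2 => conjugatedProg_bound (a := 3) (b := 4) hD h2 ht⟩

end SHT

theorem mainTheorem7 :
    (∃ C : ℝ, 0 < C ∧ ∀ m Δ B : ℕ, Δ * B = 2 ^ m →
      ∀ v : EuclideanSpace ℝ (Fin (Δ * B)), ‖v‖ ≤ 1 →
        SHT.expectedError v ≤ C * (Real.log ((Δ * B : ℕ) : ℝ) ^ 2 / (B : ℝ)) ∧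
        SHT.expectedError v ≤ C * (Real.log ((Δ * B : ℕ) : ℝ) / Real.sqrt (B : ℝ))) ∧
    (∃ (p : SHT.Prog) (K : ℝ), SHT.MultipliesWithin (fun W => W) p K) ∧
    (∃ (p : SHT.Prog) (K : ℝ), SHT.MultipliesWithin (fun W => Matrix.transpose W) p K) :=
  ⟨SHT.exists_expectedError_bounds, SHT.exists_multipliesWithin,
    SHT.exists_multipliesWithin_transpose⟩
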